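/- For $\alpha>0$ let $w_\alpha(x)=(1-x^2)^\alpha$ on $(-1,1)$, let $p_n$, $n=0,1,2,\dots$, be the orthonormal polynomials with respect to $w_\alpha$ ($\deg p_n=n$, positive leading coefficient, $\int_{-1}^1 p_mp_nw_\alpha\,dx=\delta_{m,n}$), let $\varphi_n=\sqrt{w_\alpha}\,p_n$, and let $\mathcal D$ be the infinite matrix with the entries $$\mathcal D_{m,n}=\int_{-1}^1\varphi_m'(x)\varphi_n(x)\,dx,\qquad m,n\ge 0 .$$ For $k\ge 1$ call $\mathcal D^k$ bounded if the integrals that define the entries of $\mathcal D$ exist and, for all $m,n\ge 0$, the $(k-1)$-fold series $$(\mathcal D^k)_{m,n}=\sum_{j_1=0}^\infty\cdots\sum_{j_{k-1}=0}^\infty \mathcal D_{m,j_1}\mathcal D_{j_1,j_2}\cdots\mathcal D_{j_{k-1},n}$$ converges absolutely as a multiple series (no summation is needed for $k=1$). The index of $w_\alpha$, denoted by $\operatorname{ind}w_\alpha\in\{0,1,2,\dots\}\cup\{\infty\}$, is the largest $s$ such that $\mathcal D^k$ is bounded for every integer $k$ with $1\le k\le s$. Theorem 8. Let $\alpha>0$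 and let $s\ge 1$ be an integer. Then $\operatorname{ind}w_\alpha\ge s$ if and only if $\alpha>s-1$. -/

import Mathlib

open MeasureTheory

noncomputable section

namespace WFun

/-- The weighted inner product `∫_I p q w` of two real polynomials. -/
def wInner (I : Set ℝ) (w : ℝ → ℝ) (p q : Polynomial ℝ) : ℝ :=
  ∫ x in I, p.eval x * q.eval x * w x

/-- One Gram-Schmidt step: normalisation of a polynomial in the weighted inner product. -/
def normalise (I : Set ℝ) (w : ℝ → ℝ) (q : Polynomial ℝ) : Polynomial ℝ :=
  Polynomial.C (Real.sqrt (wInner I w q q))⁻¹ * q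

/-- The orthonormal polynomials of the weight `w` on `I`: Gram-Schmidt applied to
`1, X, X², …`. Each `orthoPoly I w n` has degree `n` and a positive leading coefficient. -/
def orthoPoly (I : Set ℝ) (w : ℝ → ℝ) (n : ℕ) : Polynomial ℝ :=
  normalise I w
    (Polynomial.X ^ n -
      ∑ k : Fin n,
        Polynomial.C (wInner I w (Polynomial.X ^ n) (orthoPoly I w k.1)) * orthoPoly I w k.1)
termination_by n
decreasing_by all_goals exact k.2

/-- The `n`-th W-function `φₙ = √w pₙ`. -/
def wFun (I : Set ℝ) (w : ℝ → ℝ) (n : ℕ) (x : ℝ) : ℝ :=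
  Real.sqrt (w x) * (orthoPoly I w n).eval x

/-- The infinite differentiation matrix `D m n = ∫_I φₘ' φₙ`. -/
def diffMatrix (I : Set ℝ) (w : ℝ → ℝ) (m n : ℕ) : ℝ :=
  ∫ x in I, deriv (wFun I w m) x * wFun I w n x

/-- The product `D m κ₀ * D κ₀ κ₁ * ⋯ * D κ_{r-1} n` over the path from `m` to `n` through the `r`
intermediate indices `κ`. -/
def pathProd (D : ℕ → ℕ → ℝ) : (r : ℕ) → (Fin r → ℕ) → ℕ → ℕ → ℝ
  | 0, _, m, n => D m n
  | r + 1, κ, m, n => D m (κ 0) * pathProd D r (fun i => κ i.succ) (κ 0) n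

/-- The power `D ^ k` of the infinite matrix `D` is bounded: for `k = r + 1`, every entry, the
`r`-fold series `∑_{κ₀, …, κ_{r-1}} D m κ₀ * D κ₀ κ₁ * ⋯ * D κ_{r-1} n`, converges as a multiple
series (for real terms, `Summable` is the same as absolute convergence). -/
def PowerBounded (D : ℕ → ℕ → ℝ) : ℕ → Prop
  | 0 => True
  | r + 1 => ∀ m n : ℕ, Summable fun κ : Fin r → ℕ => pathProd D r κ m n

/-- All the integrals that define the entries of the differentiation matrix converge. -/
def EntriesFinite (I : Set ℝ) (w : ℝ → ℝ) : Prop :=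
  ∀ m n : ℕ, IntegrableOn (fun x => deriv (wFun I w m) x * wFun I w n x) I

/-- The index of `w` on `I`: the largest `s ≤ ∞` such that `D ^ k` is bounded for all finite `k`
with `1 ≤ k ≤ s`. -/
def index (I : Set ℝ) (w : ℝ → ℝ) : ℕ∞ :=
  sSup {s : ℕ∞ | ∀ k : ℕ, 1 ≤ k → (k : ℕ∞) ≤ s →
    EntriesFinite I w ∧ PowerBounded (diffMatrix I w) k}

/-- The ultraspherical weight; it is only used on the interval `(-1, 1)`. -/
def ultraspherical (α : ℝ) (x : ℝ) : ℝ := (1 - x ^ 2) ^ α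

end WFun

end

/-! Put `a = α + 1/2`. Subtracting the integral of `(pₘ pₙ w)'`, which vanishes, from twice an entry
leaves `2 D m n = ∫ (pₘ' pₙ - pₘ pₙ') w`. Hence `D` is skew-symmetric and vanishes when `m + n` is
even. For `m < n` with `m + n` odd, integration by parts gives the exact value `-(n + a) pₘ(1) /
pₙ(1)` (`diffMatrix_ultraspherical_of_lt`).

Ladder relations for `(1 - x²) pₙ'`, read at `x = 1`, give a recursion for `pₙ(1)²`. Euler's limit
for the Gamma function then shows that `pₙ(1)` has order `n ^ a`, so the nonzero entries have order
`min ^ a * max ^ (1 - a)` (indices shifted by one).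

Only this size matters for the powers. Each additional factor raises the growth exponent in the free
index by 2, starting from `1 - a`. The last sum for `D ^ k` compares with `∑ j ^ (2 * (k - 1) - 2 *
a)`, which converges exactly when `a > k - 1/2`, that is `α > k - 1`. The two directions are
`powerBounded_of_abs_le` and `not_powerBounded_of_le_abs`. -/

noncomputable section

/-! ### Orthonormal polynomials of an abstract linear functional. -/

namespace WFun

open Polynomial

/-- A sequence of polynomials `p n` of degree `n` with positive leading coefficients which is
orthonormal with respect to the linear functional `L`. -/
structure IsOrthonormalSeq (L : ℝ[X] →ₗ[ℝ] ℝ) (p : ℕ → ℝ[X]) : Prop where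
  natDegree_eq : ∀ n, (p n).natDegree = n
  coeff_pos : ∀ n, 0 < (p n).coeff n
  orthonormal : ∀ m n, L (p m * p n) = if m = n then 1 else 0

theorem map_C_mul (L : ℝ[X] →ₗ[ℝ] ℝ) (c : ℝ) (f : ℝ[X]) : L (C c * f) = c * L f := by
  rw [← smul_eq_C_mul, map_smul, smul_eq_mul]

/-- Gram-Schmidt yields an orthonormal sequence. -/
theorem isOrthonormalSeq_orthoPoly {I : Set ℝ} {w : ℝ → ℝ} {L : ℝ[X] →ₗ[ℝ] ℝ}
    (hL : ∀ p q, wInner I w p q = L (p * q)) (hpos : ∀ p ≠ 0, 0 < L (p * p)) :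
    IsOrthonormalSeq L (orthoPoly I w) := by
  have key : ∀ n, ((orthoPoly I w n).natDegree = n ∧ 0 < (orthoPoly I w n).coeff n) ∧
      (∀ m < n, L (orthoPoly I w n * orthoPoly I w m) = 0) ∧
      L (orthoPoly I w n * orthoPoly I w n) = 1 := by
    intro n
    induction n using Nat.strong_induction_on with
    | _ n ih =>
    have hcross : ∀ i < n, ∀ j < n,
        L (orthoPoly I w i * orthoPoly I w j) = if i = j then 1 else 0 := by
      intro i hi j hj
      rcases lt_trichotomy i j with h | h | h
      · rw [mul_comm, (ih j hj).2.1 i h, if_neg h.ne]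
      · subst h; rw [(ih i hi).2.2, if_pos rfl]
      · rw [(ih i hi).2.1 j h, if_neg h.ne']
    set g : ℝ[X] := ∑ k : Fin n,
      C (wInner I w (X ^ n) (orthoPoly I w k.1)) * orthoPoly I w k.1 with hg
    set q : ℝ[X] := X ^ n - g with hq
    have hgdeg : g.degree < n := by
      rw [hg]
      refine lt_of_le_of_lt (degree_sum_le _ _) ?_
      rw [Finset.sup_lt_iff (by exact_mod_cast WithBot.bot_lt_coe n)]
      intro k _
      refine lt_of_le_of_lt degree_le_natDegree ?_
      exact_mod_cast (natDegree_C_mul_le _ _).trans_lt ((ih k.1 k.2).1.1.trans_lt k.2)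
    have hqdeg : q.natDegree = n := by
      rw [hq]
      apply natDegree_eq_of_degree_eq_some
      rw [degree_sub_eq_left_of_degree_lt] <;> rw [degree_X_pow]
      exact hgdeg
    have hqcoeff : q.coeff n = 1 := by
      rw [hq, coeff_sub, coeff_X_pow_self, coeff_eq_zero_of_degree_lt hgdeg, sub_zero]
    have hq0 : q ≠ 0 := by
      intro h; rw [h] at hqcoeff; simp at hqcoeff
    have hqorth : ∀ m < n, L (q * orthoPoly I w m) = 0 := by
      intro m hm
      rw [hq, sub_mul, map_sub, hg, Finset.sum_mul, map_sum]
      have : ∀ k : Fin n, L (C (wInner I w (X ^ n) (orthoPoly I w k.1)) * orthoPoly I w k.1 *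
          orthoPoly I w m) = if k = ⟨m, hm⟩ then L (X ^ n * orthoPoly I w m) else 0 := by
        intro k
        rw [mul_assoc, map_C_mul, hcross k.1 k.2 m hm, hL]
        by_cases h : k = ⟨m, hm⟩
        · subst h; simp
        · rw [if_neg h, if_neg, mul_zero]
          intro h'; exact h (Fin.ext h')
      rw [Finset.sum_congr rfl fun k _ => this k]
      simp
    have hN := hpos q hq0
    have hs : 0 < (Real.sqrt (L (q * q)))⁻¹ := inv_pos.2 (Real.sqrt_pos.2 hN)
    have hp : orthoPoly I w n = C (Real.sqrt (L (q * q)))⁻¹ * q := by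
      rw [orthoPoly, normalise, ← hg, ← hq, hL]
    rw [hp]
    refine ⟨⟨?_, ?_⟩, ?_, ?_⟩
    · rw [natDegree_C_mul hs.ne', hqdeg]
    · rw [coeff_C_mul, hqcoeff, mul_one]; exact hs
    · intro m hm
      rw [mul_assoc, map_C_mul, hqorth m hm, mul_zero]
    · rw [mul_mul_mul_comm, ← C_mul, map_C_mul, ← mul_inv, Real.mul_self_sqrt hN.le,
        inv_mul_cancel₀ hN.ne']
  refine ⟨fun n => (key n).1.1, fun n => (key n).1.2, fun m n => ?_⟩
  rcases lt_trichotomy m n with h | h | h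
  · rw [mul_comm, (key n).2.1 m h, if_neg h.ne]
  · subst h; rw [(key m).2.2, if_pos rfl]
  · rw [(key m).2.1 n h, if_neg h.ne']

namespace IsOrthonormalSeq

variable {L : ℝ[X] →ₗ[ℝ] ℝ} {p : ℕ → ℝ[X]}

theorem exists_eq_add (hp : IsOrthonormalSeq L p) {n : ℕ} {f : ℝ[X]} (hf : f.degree < n + 1) :
    ∃ g : ℝ[X], g.degree < n ∧ f = C (f.coeff n / (p n).coeff n) * p n + g := by
  refine ⟨f - C (f.coeff n / (p n).coeff n) * p n, ?_, by ring⟩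
  rw [degree_lt_iff_coeff_zero]
  intro m hm
  rw [coeff_sub, coeff_C_mul]
  rcases hm.eq_or_lt with rfl | h
  · rw [div_mul_cancel₀ _ (hp.coeff_pos _).ne', sub_self]
  · rw [coeff_eq_zero_of_degree_lt (lt_of_lt_of_le hf (by exact_mod_cast h)),
      coeff_eq_zero_of_natDegree_lt ((hp.natDegree_eq n).trans_lt h)]
    simp

theorem map_mul_eq_zero (hp : IsOrthonormalSeq L p) {n : ℕ} {f : ℝ[X]} (hf : f.degree < n) :
    L (f * p n) = 0 := by
  have key : ∀ N : ℕ, ∀ f : ℝ[X], f.degree < N → ∀ n, N ≤ n → L (f * p n) = 0 := by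
    intro N
    induction N with
    | zero =>
      intro f hf n _
      rw [show f = 0 by simpa [Nat.WithBot.lt_zero_iff] using hf, zero_mul, map_zero]
    | succ N ih =>
      intro f hf n hn
      obtain ⟨g, hg, hfg⟩ := hp.exists_eq_add (n := N) (f := f) (by exact_mod_cast hf)
      rw [hfg, add_mul, map_add, ih g hg n (by omega), mul_assoc, map_C_mul, hp.orthonormal,
        if_neg (by omega)]
      simp
  exact key n f hf n le_rfl

/-- Only the leading term of `f` survives orthogonality, so Fourier coefficients can be read off
from polynomial coefficients. -/
theorem map_mul_eq_div (hp : IsOrthonormalSeq L p) {n : ℕ} {f : ℝ[X]} (hf : f.degree < n + 1) :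
    L (f * p n) = f.coeff n / (p n).coeff n := by
  obtain ⟨g, hg, hfg⟩ := hp.exists_eq_add hf
  conv_lhs => rw [hfg]
  rw [add_mul, map_add, hp.map_mul_eq_zero hg, mul_assoc, map_C_mul, hp.orthonormal]
  simp

/-- Expansion in orthonormal polynomials. -/
theorem eq_sum (hp : IsOrthonormalSeq L p) {N : ℕ} {f : ℝ[X]} (hf : f.degree < N) :
    f = ∑ j ∈ Finset.range N, C (L (f * p j)) * p j := by
  induction N generalizing f with
  | zero => simpa [Nat.WithBot.lt_zero_iff] using hf
  | succ N ih =>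
    have hf' : f.degree < (N : WithBot ℕ) + 1 := by exact_mod_cast hf
    obtain ⟨g, hg, hfg⟩ := hp.exists_eq_add hf'
    rw [Finset.sum_range_succ, hp.map_mul_eq_div hf']
    conv_lhs => rw [hfg, add_comm, ih hg]
    congr 1
    refine Finset.sum_congr rfl fun j hj => ?_
    conv_rhs => rw [hfg]
    rw [add_mul, map_add, mul_assoc, map_C_mul, hp.orthonormal,
      if_neg (Finset.mem_range.1 hj).ne', mul_zero, zero_add]

/-- A polynomial of low degree with a single nonzero Fourier coefficient. -/
theorem eq_C_mul (hp : IsOrthonormalSeq L p) {N i : ℕ} {f : ℝ[X]} (hi : i < N)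
    (hf : f.degree < N) (h : ∀ j < N, j ≠ i → L (f * p j) = 0) :
    f = C (L (f * p i)) * p i := by
  conv_lhs => rw [hp.eq_sum hf]
  rw [Finset.sum_eq_single_of_mem i (Finset.mem_range.2 hi)]
  intro j hj hji
  rw [h j (Finset.mem_range.1 hj) hji, C_0, zero_mul]

theorem degree_eq (hp : IsOrthonormalSeq L p) (n : ℕ) : (p n).degree = n := by
  rw [degree_eq_natDegree, hp.natDegree_eq]
  intro h
  have := hp.coeff_pos n
  rw [h] at this
  simp at this

/-- Since `L` is even, the reflected polynomial is still orthogonal to all lower `p j`, hence a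
multiple of `p n`; leading coefficients fix the factor. -/
theorem comp_neg_X (hp : IsOrthonormalSeq L p) (heven : ∀ f : ℝ[X], L (f.comp (-X)) = L f)
    (n : ℕ) : (p n).comp (-X) = C ((-1) ^ n) * p n := by
  have hdeg : ∀ j, ((p j).comp (-X)).natDegree = j := by
    intro j; rw [natDegree_comp]; simp [hp.natDegree_eq]
  have hlt : ∀ j, ((p j).comp (-X)).degree < ((j + 1 : ℕ) : WithBot ℕ) := by
    intro j
    refine lt_of_le_of_lt degree_le_natDegree ?_
    rw [hdeg]; exact_mod_cast Nat.lt_succ_self j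
  have h1 := hp.eq_C_mul (N := n + 1) (i := n) (f := (p n).comp (-X)) (Nat.lt_succ_self n)
    (hlt n) (fun j hj hjn => by
      rw [← heven, mul_comp, comp_assoc]
      simp only [neg_comp, X_comp, neg_neg, comp_X]
      rw [mul_comm]
      exact hp.map_mul_eq_zero (lt_of_lt_of_le (hlt j) (by exact_mod_cast (by omega : j + 1 ≤ n))))
  rw [hp.map_mul_eq_div (by exact_mod_cast hlt n)] at h1
  rw [h1]
  congr 2
  have h2 : ((p n).comp (-X)).coeff n = (-1) ^ n * (p n).coeff n := by
    have := comp_neg_X_leadingCoeff_eq (p n)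
    rwa [leadingCoeff, leadingCoeff, hdeg, hp.natDegree_eq] at this
  rw [h2, mul_div_cancel_right₀ _ (hp.coeff_pos n).ne']

theorem eval_neg_one (hp : IsOrthonormalSeq L p) (heven : ∀ f : ℝ[X], L (f.comp (-X)) = L f)
    (n : ℕ) : (p n).eval (-1) = (-1) ^ n * (p n).eval 1 := by
  have := congrArg (eval 1) (hp.comp_neg_X heven n)
  simpa [eval_comp] using this

end IsOrthonormalSeq

theorem map_eq_zero_of_odd {L : ℝ[X] →ₗ[ℝ] ℝ} (heven : ∀ f : ℝ[X], L (f.comp (-X)) = L f)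
    {f : ℝ[X]} (hf : f.comp (-X) = -f) : L f = 0 := by
  have := heven f
  rw [hf, map_neg] at this
  linarith

end WFun

end

/-! ### Ladder relations and endpoint values from the Pearson equation. -/

noncomputable section

namespace WFun

open Polynomial

theorem coeff_X_mul_derivative (f : ℝ[X]) (m : ℕ) :
    (X * derivative f).coeff m = m * f.coeff m := by
  cases m with
  | zero => simp
  | succ m => rw [coeff_X_mul, coeff_derivative]; push_cast; ring

theorem coeff_one_sub_X_sq_mul_derivative (f : ℝ[X]) (m : ℕ) :
    ((1 - X ^ 2) * derivative f).coeff (m + 1) = (m + 2) * f.coeff (m + 2) - m * f.coeff m := by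
  rw [show (1 - X ^ 2) * derivative f = derivative f - X * (X * derivative f) by ring, coeff_sub,
    coeff_X_mul, coeff_X_mul_derivative, coeff_derivative]
  push_cast; ring

theorem degree_one_sub_X_sq_mul_derivative_lt {f : ℝ[X]} {N : ℕ} (hf : f.degree < N) :
    ((1 - X ^ 2) * derivative f).degree < ((N + 1 : ℕ) : WithBot ℕ) := by
  rw [degree_lt_iff_coeff_zero] at hf ⊢
  rintro (_ | m) hm
  · omega
  · rw [coeff_one_sub_X_sq_mul_derivative, hf m (by omega), hf (m + 2) (by omega)]
    simp

theorem degree_C_mul_X_mul_lt {f : ℝ[X]} {N : ℕ} (c : ℝ) (hf : f.degree < N) :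
    (C c * (X * f)).degree < ((N + 1 : ℕ) : WithBot ℕ) := by
  rw [degree_lt_iff_coeff_zero] at hf ⊢
  rintro (_ | m) hm
  · omega
  · rw [coeff_C_mul, coeff_X_mul, hf m (by omega), mul_zero]

/-- The linear functional satisfies the Pearson equation of the weight `(1 - x²)^α`, and is
even. -/
structure IsUltrasphericalFunctional (α : ℝ) (L : ℝ[X] →ₗ[ℝ] ℝ) : Prop where
  pearson : ∀ f : ℝ[X], L ((1 - X ^ 2) * derivative f) = 2 * (α + 1) * L (X * f)
  even : ∀ f : ℝ[X], L (f.comp (-X)) = L f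

namespace IsUltrasphericalFunctional

variable {α : ℝ} {L : ℝ[X] →ₗ[ℝ] ℝ} {p : ℕ → ℝ[X]}

/-- The Pearson equation applied to `f * g`: it gives the adjoint of `(1 - X²) d/dX`, again an
operator raising degrees by at most one. -/
theorem map_by_parts (hL : IsUltrasphericalFunctional α L) (f g : ℝ[X]) :
    L ((1 - X ^ 2) * derivative f * g) =
      L ((C (2 * (α + 1)) * (X * g) - (1 - X ^ 2) * derivative g) * f) := by
  have h := hL.pearson (f * g)
  rw [derivative_mul, mul_add, map_add] at h
  rw [sub_mul _ _ f, map_sub, mul_assoc (C _), map_C_mul]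
  rw [show (1 - X ^ 2) * derivative f * g = (1 - X ^ 2) * (derivative f * g) by ring,
    show X * g * f = X * (f * g) by ring,
    show (1 - X ^ 2) * derivative g * f = (1 - X ^ 2) * (f * derivative g) by ring]
  linarith

theorem derivative_comp_neg_X (hL : IsUltrasphericalFunctional α L) (hp : IsOrthonormalSeq L p)
    (n : ℕ) : (derivative (p n)).comp (-X) = -(C ((-1) ^ n) * derivative (p n)) := by
  have h := congrArg derivative (hp.comp_neg_X hL.even n)
  rw [derivative_comp, derivative_C_mul, derivative_neg, derivative_X] at h
  rw [← h]; ring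

theorem map_X_mul_self (hL : IsUltrasphericalFunctional α L) (hp : IsOrthonormalSeq L p) (n : ℕ)
    (c d : ℝ) : L ((C c * (X * p n) + C d * ((1 - X ^ 2) * derivative (p n))) * p n) = 0 := by
  apply map_eq_zero_of_odd hL.even
  have h1 : (C ((-1) ^ n) : ℝ[X]) * C ((-1) ^ n) = 1 := by
    rw [← C_mul, ← mul_pow]; simp
  simp only [mul_comp, add_comp, sub_comp, pow_comp, X_comp, C_comp, one_comp,
    hp.comp_neg_X hL.even, hL.derivative_comp_neg_X hp]
  linear_combination (-(C c * X * p n * p n) - C d * ((1 - X ^ 2) * derivative (p n)) * p n) * h1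

/-- The left side has degree at most `n + 1`. Its `p n` component vanishes by parity, those below `n
- 1` by taking adjoints, and `n + 2α + 1` is the constant that also kills the `p (n - 1)` component.
-/
theorem structure_raise (hL : IsUltrasphericalFunctional α L) (hp : IsOrthonormalSeq L p)
    (n : ℕ) : C (n + 2 * α + 1) * (X * p n) - (1 - X ^ 2) * derivative (p n) =
      C ((2 * n + 2 * α + 1) * ((p n).coeff n / (p (n + 1)).coeff (n + 1))) * p (n + 1) := by
  set g : ℝ[X] := C (n + 2 * α + 1) * (X * p n) - (1 - X ^ 2) * derivative (p n) with hg
  have hlt : ∀ j, (p j).degree < ((j + 1 : ℕ) : WithBot ℕ) := fun j => by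
    rw [hp.degree_eq]; exact_mod_cast Nat.lt_succ_self j
  have hgd : g.degree < ((n + 1 + 1 : ℕ) : WithBot ℕ) :=
    (degree_sub_le _ _).trans_lt (max_lt (degree_C_mul_X_mul_lt _ (hlt n))
      (degree_one_sub_X_sq_mul_derivative_lt (hlt n)))
  have h0 : ∀ j < n + 1 + 1, j ≠ n + 1 → L (g * p j) = 0 := by
    intro j hj hjn
    rcases (by omega : j = n ∨ j < n) with rfl | hlt'
    · have := hL.map_X_mul_self hp j (j + 2 * α + 1) (-1)
      rwa [show (C (-1 : ℝ) : ℝ[X]) = -1 by simp, neg_one_mul, ← sub_eq_add_neg, ← hg] at this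
    · obtain ⟨n, rfl⟩ : ∃ m, n = m + 1 := ⟨n - 1, by omega⟩
      set h : ℝ[X] := C ((n + 1 : ℕ) + 2 * α + 1) * (X * p j) -
        (C (2 * (α + 1)) * (X * p j) - (1 - X ^ 2) * derivative (p j)) with hh
      have e : L (g * p j) = L (h * p (n + 1)) := by
        rw [hg, sub_mul, map_sub, hL.map_by_parts, ← map_sub, hh]
        congr 1; ring
      have hlt2 : (p j).degree < ((n + 1 : ℕ) : WithBot ℕ) :=
        (hlt j).trans_le (by exact_mod_cast hlt')
      rw [e, hp.map_mul_eq_div, hh, coeff_sub, coeff_sub, coeff_C_mul, coeff_C_mul, coeff_X_mul,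
        coeff_one_sub_X_sq_mul_derivative,
        (degree_lt_iff_coeff_zero _ _).1 hlt2 (n + 2) (by omega)]
      · push_cast; ring
      · exact (degree_sub_le _ _).trans_lt (max_lt (degree_C_mul_X_mul_lt _ hlt2)
          ((degree_sub_le _ _).trans_lt (max_lt (degree_C_mul_X_mul_lt _ hlt2)
            (degree_one_sub_X_sq_mul_derivative_lt hlt2))))
  rw [hp.eq_C_mul (Nat.lt_succ_self (n + 1)) hgd h0, hp.map_mul_eq_div (by exact_mod_cast hgd)]
  congr 2
  rw [hg, coeff_sub, coeff_C_mul, coeff_X_mul, coeff_one_sub_X_sq_mul_derivative,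
    (degree_lt_iff_coeff_zero _ _).1 (hlt n) (n + 2) (by omega)]
  ring

/-- Here the constant `n + 1` cancels the terms of degree `n + 2`. Parity removes the `p (n + 1)`
component and the adjoint removes those below `n`. -/
theorem structure_lower (hL : IsUltrasphericalFunctional α L) (hp : IsOrthonormalSeq L p)
    (n : ℕ) : (1 - X ^ 2) * derivative (p (n + 1)) + C (n + 1 : ℝ) * (X * p (n + 1)) =
      C ((2 * n + 2 * α + 3) * ((p n).coeff n / (p (n + 1)).coeff (n + 1))) * p n := by
  set g : ℝ[X] := (1 - X ^ 2) * derivative (p (n + 1)) + C (n + 1 : ℝ) * (X * p (n + 1)) with hg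
  have hlt : ∀ j, (p j).degree < ((j + 1 : ℕ) : WithBot ℕ) := fun j => by
    rw [hp.degree_eq]; exact_mod_cast Nat.lt_succ_self j
  have hgd : g.degree < ((n + 1 + 1 : ℕ) : WithBot ℕ) := by
    rw [degree_lt_iff_coeff_zero]
    rintro (_ | m) hm
    · omega
    have hc := (degree_lt_iff_coeff_zero _ _).1 (hlt (n + 1))
    rw [hg, coeff_add, coeff_C_mul, coeff_X_mul, coeff_one_sub_X_sq_mul_derivative,
      hc (m + 2) (by omega)]
    rcases (by omega : m = n + 1 ∨ n + 1 + 1 ≤ m) with rfl | h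
    · push_cast; ring
    · rw [hc m h]; ring
  have hmap : ∀ j, L (g * p j) = L ((C (2 * (α + 1)) * (X * p j) -
      (1 - X ^ 2) * derivative (p j) + C (n + 1 : ℝ) * (X * p j)) * p (n + 1)) := by
    intro j
    rw [hg, add_mul, map_add, hL.map_by_parts, ← map_add]
    congr 1; ring
  have hdeg : ∀ j, (C (2 * (α + 1)) * (X * p j) -
      (1 - X ^ 2) * derivative (p j) + C (n + 1 : ℝ) * (X * p j)).degree <
        ((j + 1 + 1 : ℕ) : WithBot ℕ) := fun j =>
    (degree_add_le _ _).trans_lt (max_lt ((degree_sub_le _ _).trans_lt (max_lt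
      (degree_C_mul_X_mul_lt _ (hlt j)) (degree_one_sub_X_sq_mul_derivative_lt (hlt j))))
      (degree_C_mul_X_mul_lt _ (hlt j)))
  have h0 : ∀ j < n + 1 + 1, j ≠ n → L (g * p j) = 0 := by
    intro j hj hjn
    rcases (by omega : j = n + 1 ∨ j < n) with rfl | hlt'
    · have := hL.map_X_mul_self hp (n + 1) (n + 1) 1
      rwa [C_1, one_mul, add_comm (C _ * _), ← hg] at this
    · rw [hmap]
      exact hp.map_mul_eq_zero ((hdeg j).trans_le (by exact_mod_cast (by omega)))
  rw [hp.eq_C_mul (by omega) hgd h0, hmap, hp.map_mul_eq_div (by exact_mod_cast hdeg n)]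
  congr 2
  rw [coeff_add, coeff_sub, coeff_C_mul, coeff_C_mul, coeff_X_mul,
    coeff_one_sub_X_sq_mul_derivative,
    (degree_lt_iff_coeff_zero _ _).1 (hlt n) (n + 2) (by omega)]
  ring

theorem eval_one_raise (hL : IsUltrasphericalFunctional α L) (hp : IsOrthonormalSeq L p)
    (n : ℕ) : (n + 2 * α + 1) * (p n).eval 1 =
      (2 * n + 2 * α + 1) * ((p n).coeff n / (p (n + 1)).coeff (n + 1)) * (p (n + 1)).eval 1 := by
  simpa using congrArg (eval 1) (hL.structure_raise hp n)

theorem eval_one_lower (hL : IsUltrasphericalFunctional α L) (hp : IsOrthonormalSeq L p)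
    (n : ℕ) : (n + 1) * (p (n + 1)).eval 1 =
      (2 * n + 2 * α + 3) * ((p n).coeff n / (p (n + 1)).coeff (n + 1)) * (p n).eval 1 := by
  simpa using congrArg (eval 1) (hL.structure_lower hp n)

theorem eval_one_pos (hL : IsUltrasphericalFunctional α L) (hp : IsOrthonormalSeq L p)
    (hα : 0 < α) (n : ℕ) : 0 < (p n).eval 1 := by
  induction n with
  | zero =>
    rw [eq_C_of_natDegree_eq_zero (hp.natDegree_eq 0), eval_C]
    exact hp.coeff_pos 0
  | succ n ih =>
    have h := hL.eval_one_lower hp n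
    have h1 := div_pos (hp.coeff_pos n) (hp.coeff_pos (n + 1))
    have h2 : 0 < ((n : ℝ) + 1) * (p (n + 1)).eval 1 := by rw [h]; positivity
    exact pos_of_mul_pos_right h2 (by positivity)

/-- At `x = 1` the derivative terms of both ladder relations drop out; eliminating the ratio of
leading coefficients leaves this recursion. -/
theorem eval_one_sq_succ (hL : IsUltrasphericalFunctional α L) (hp : IsOrthonormalSeq L p)
    (n : ℕ) : (n + 1) * (2 * n + 2 * α + 1) * (p (n + 1)).eval 1 ^ 2 =
      (2 * n + 2 * α + 3) * (n + 2 * α + 1) * (p n).eval 1 ^ 2 := by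
  linear_combination (2 * n + 2 * α + 1) * (p (n + 1)).eval 1 * hL.eval_one_lower hp n -
    (2 * n + 2 * α + 3) * (p n).eval 1 * hL.eval_one_raise hp n

/-- By parity, `p m` and a suitable multiple of `p (n - 1)` agree at both endpoints, so they differ
by `(1 - X²) r`. Integration by parts makes `p n'` orthogonal to that difference, which leaves a
pairing of `p n'` with `p (n - 1)`, a matter of leading coefficients. -/
theorem map_derivative_mul (hL : IsUltrasphericalFunctional α L) (hp : IsOrthonormalSeq L p)
    (hα : 0 < α) {m n : ℕ} (hmn : m < n) (hodd : Odd (m + n)) :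
    L (derivative (p n) * p m) = (2 * n + 2 * α + 1) * ((p m).eval 1 / (p n).eval 1) := by
  -- From here `n` is the predecessor of the original index, and has the parity of `m`.
  obtain ⟨n, rfl⟩ : ∃ k, n = k + 1 := ⟨n - 1, by omega⟩
  have hP := hL.eval_one_pos hp hα
  have heven : ((-1 : ℝ)) ^ m = (-1) ^ n := by
    have h1 : (-1 : ℝ) ^ (m + (n + 1)) = -1 := hodd.neg_one_pow
    have h2 : ((-1 : ℝ) ^ n) * (-1) ^ n = 1 := by rw [← mul_pow]; simp
    rw [pow_add, pow_succ] at h1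
    linear_combination (-1 : ℝ) ^ n * (-1) * h1 - (-1) ^ m * h2
  set c := (p m).eval 1 / (p n).eval 1 with hc
  have hc' : c * (p n).eval 1 = (p m).eval 1 := div_mul_cancel₀ _ (hP n).ne'
  have hdvd : (1 - X ^ 2 : ℝ[X]) ∣ p m - C c * p n := by
    have h1 : (X - C 1 : ℝ[X]) ∣ p m - C c * p n := by
      rw [dvd_iff_isRoot, IsRoot.def, eval_sub, eval_mul, eval_C, hc', sub_self]
    have h2 : (X - C (-1) : ℝ[X]) ∣ p m - C c * p n := by
      rw [dvd_iff_isRoot, IsRoot.def, eval_sub, eval_mul, eval_C, hp.eval_neg_one hL.even,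
        hp.eval_neg_one hL.even, heven]
      linear_combination -(-1 : ℝ) ^ n * hc'
    have h3 := (isCoprime_X_sub_C_of_isUnit_sub (R := ℝ) (a := 1) (b := -1)
      (by norm_num)).mul_dvd h1 h2
    rw [← neg_dvd]
    convert h3 using 1
    simp; ring
  obtain ⟨r, hr⟩ := hdvd
  have hlt : ∀ j, (p j).degree < ((j + 1 : ℕ) : WithBot ℕ) := fun j => by
    rw [hp.degree_eq]; exact_mod_cast Nat.lt_succ_self j
  have hrdeg : r.degree < (n : WithBot ℕ) := by
    by_cases hr0 : r = 0
    · rw [hr0, degree_zero]; exact WithBot.bot_lt_coe n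
    have h2 : (1 - X ^ 2 : ℝ[X]).natDegree = 2 := by
      rw [← neg_sub, natDegree_neg, ← C_1, natDegree_X_pow_sub_C]
    have h20 : (1 - X ^ 2 : ℝ[X]) ≠ 0 := by
      intro h; rw [h] at h2; simp at h2
    have h3 : (p m - C c * p n).natDegree ≤ n := by
      refine (natDegree_sub_le _ _).trans (max_le ?_ ((natDegree_C_mul_le _ _).trans ?_))
      · rw [hp.natDegree_eq]; omega
      · rw [hp.natDegree_eq]
    rw [hr, natDegree_mul h20 hr0, h2] at h3
    exact degree_le_natDegree.trans_lt (by exact_mod_cast (by omega))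
  have hz : L (derivative (p (n + 1)) * ((1 - X ^ 2) * r)) = 0 := by
    rw [show derivative (p (n + 1)) * ((1 - X ^ 2) * r) =
      (1 - X ^ 2) * derivative (p (n + 1)) * r by ring, hL.map_by_parts]
    exact hp.map_mul_eq_zero ((degree_sub_le _ _).trans_lt (max_lt
      (degree_C_mul_X_mul_lt _ hrdeg) (degree_one_sub_X_sq_mul_derivative_lt hrdeg)))
  have hd : L (derivative (p (n + 1)) * p n) =
      (n + 1) * (p (n + 1)).coeff (n + 1) / (p n).coeff n := by
    rw [hp.map_mul_eq_div, coeff_derivative, mul_comm ((n : ℝ) + 1)]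
    have := degree_derivative_lt (p := p (n + 1)) (by
      intro h; have := hp.coeff_pos (n + 1); rw [h] at this; simp at this)
    rw [hp.degree_eq] at this
    exact_mod_cast this
  have hm : p m = C c * p n + (1 - X ^ 2) * r := by rw [← hr]; ring
  rw [hm, mul_add, map_add, hz, mul_left_comm, map_C_mul, hd, add_zero, ← hm]
  have h := hL.eval_one_lower hp n
  have k1 := (hp.coeff_pos n).ne'
  have k2 := (hp.coeff_pos (n + 1)).ne'
  have k3 := (hP (n + 1)).ne'
  have k4 := (hP n).ne'
  rw [hc]
  field_simp at h ⊢
  push_cast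
  linear_combination (p m).eval 1 * h

end IsUltrasphericalFunctional

end WFun

end

/-! ### The weight `(1 - x²)^α` and the exact entries of its differentiation matrix. -/

noncomputable section

namespace WFun

open Polynomial

theorem setIntegral_Ioo_eq_intervalIntegral (f : ℝ → ℝ) :
    ∫ x in Set.Ioo (-1 : ℝ) 1, f x = ∫ x in (-1 : ℝ)..1, f x := by
  rw [intervalIntegral.integral_of_le (by norm_num), integral_Ioc_eq_integral_Ioo]

theorem continuous_ultraspherical {α : ℝ} (hα : 0 ≤ α) : Continuous (ultraspherical α) := by
  unfold ultraspherical
  exact Continuous.rpow_const (by fun_prop) fun _ => Or.inr hα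

theorem one_sub_sq_pos {x : ℝ} (hx : x ∈ Set.Ioo (-1 : ℝ) 1) : 0 < 1 - x ^ 2 := by
  nlinarith [hx.1, hx.2]

theorem hasDerivAt_ultraspherical (β : ℝ) {x : ℝ} (hx : x ∈ Set.Ioo (-1 : ℝ) 1) :
    HasDerivAt (ultraspherical β) (-2 * β * x * ultraspherical (β - 1) x) x := by
  have h : HasDerivAt (fun x : ℝ => 1 - x ^ 2) (-(2 * x)) x := by
    simpa using (hasDerivAt_pow 2 x).const_sub 1
  have h1 : HasDerivAt (ultraspherical β) _ x :=
    h.rpow_const (p := β) (Or.inl (one_sub_sq_pos hx).ne')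
  exact h1.congr_deriv (by simp only [ultraspherical]; ring)

/-- Exponents down to `-1` are needed because the entries involve the exponent `α - 1`, which is
singular at the endpoints for `α < 1`. -/
theorem intervalIntegrable_ultraspherical {γ : ℝ} (hγ : -1 < γ) :
    IntervalIntegrable (ultraspherical γ) volume (-1) 1 := by
  have h1 : IntervalIntegrable (ultraspherical γ) volume 0 1 := by
    have h2 : IntervalIntegrable (fun x : ℝ => (1 - x) ^ γ) volume 0 1 := by
      simpa using ((intervalIntegral.intervalIntegrable_rpow' (a := 0) (b := 1) hγ).comp_sub_left
        1).symm
    have h3 : IntervalIntegrable (fun x : ℝ => (1 - x) ^ γ * (1 + x) ^ γ) volume 0 1 := by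
      refine h2.mul_continuousOn ?_
      rw [Set.uIcc_of_le zero_le_one]
      exact ContinuousOn.rpow_const (by fun_prop) fun x hx => Or.inl (by linarith [hx.1])
    refine h3.congr_ae ?_
    rw [Set.uIoc_of_le zero_le_one]
    refine (ae_restrict_iff' measurableSet_Ioc).2 (Filter.Eventually.of_forall fun x hx => ?_)
    simp only [ultraspherical]
    rw [← Real.mul_rpow (by linarith [hx.2]) (by linarith [hx.1])]
    congr 1; ring
  have h4 : IntervalIntegrable (ultraspherical γ) volume (-1) 0 := by
    rw [IntervalIntegrable.iff_comp_neg]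
    have h5 : (fun x => ultraspherical γ (-x)) = ultraspherical γ := by
      funext x; simp [ultraspherical]
    rw [h5, neg_neg, neg_zero]
    exact h1.symm
  exact h4.trans h1

theorem intervalIntegrable_eval_mul_ultraspherical {γ : ℝ} (hγ : -1 < γ) (f : ℝ[X]) :
    IntervalIntegrable (fun x => f.eval x * ultraspherical γ x) volume (-1) 1 :=
  (intervalIntegrable_ultraspherical hγ).continuousOn_mul f.continuous.continuousOn

/-- The integrand is the derivative of `f (1 - x²)^β`, which vanishes at `±1`. The case `β = α + 1`
gives the Pearson equation, and `β = α` the skew form of the entries. -/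
theorem integral_deriv_eval_mul_ultraspherical {β : ℝ} (hβ : 0 < β) (f : ℝ[X]) :
    ∫ x in (-1 : ℝ)..1, ((derivative f).eval x * ultraspherical β x +
      (C (-2 * β) * X * f).eval x * ultraspherical (β - 1) x) = 0 := by
  rw [intervalIntegral.integral_eq_sub_of_hasDerivAt_of_le (by norm_num)
    (f := fun x => f.eval x * ultraspherical β x)]
  · simp [ultraspherical, Real.zero_rpow hβ.ne']
  · exact (f.continuous.mul (continuous_ultraspherical hβ.le)).continuousOn
  · intro x hx
    exact ((f.hasDerivAt x).mul (hasDerivAt_ultraspherical β hx)).congr_deriv (by simp; ring)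
  · exact (intervalIntegrable_eval_mul_ultraspherical (by linarith) _).add
      (intervalIntegrable_eval_mul_ultraspherical (by linarith) _)

/-- Integration of polynomials against the ultraspherical weight. -/
def weightFunctional {α : ℝ} (hα : 0 < α) : ℝ[X] →ₗ[ℝ] ℝ where
  toFun f := ∫ x in (-1 : ℝ)..1, f.eval x * ultraspherical α x
  map_add' f g := by
    simp only [eval_add, add_mul]
    exact intervalIntegral.integral_add
      (intervalIntegrable_eval_mul_ultraspherical (by linarith) _)
      (intervalIntegrable_eval_mul_ultraspherical (by linarith) _)
  map_smul' c f := by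
    simp only [eval_smul, smul_eq_mul, mul_assoc, RingHom.id_apply]
    exact intervalIntegral.integral_const_mul _ _

theorem weightFunctional_apply {α : ℝ} (hα : 0 < α) (f : ℝ[X]) :
    weightFunctional hα f = ∫ x in (-1 : ℝ)..1, f.eval x * ultraspherical α x := rfl

theorem wInner_ultraspherical {α : ℝ} (hα : 0 < α) (p q : ℝ[X]) :
    wInner (Set.Ioo (-1) 1) (ultraspherical α) p q = weightFunctional hα (p * q) := by
  rw [wInner, setIntegral_Ioo_eq_intervalIntegral, weightFunctional_apply]
  simp only [eval_mul]

theorem weightFunctional_mul_self_pos {α : ℝ} (hα : 0 < α) {p : ℝ[X]} (hp : p ≠ 0) :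
    0 < weightFunctional hα (p * p) := by
  rw [weightFunctional_apply, ← setIntegral_Ioo_eq_intervalIntegral]
  have hint := (intervalIntegrable_iff_integrableOn_Ioo_of_le (by norm_num)).1
    (intervalIntegrable_eval_mul_ultraspherical (γ := α) (by linarith) (p * p))
  rw [setIntegral_pos_iff_support_of_nonneg_ae _ hint]
  · refine lt_of_lt_of_le ?_ (measure_mono (s := Set.Ioo (-1 : ℝ) 1 \ (p.roots.toFinset : Set ℝ)) ?_)
    · rw [measure_sdiff_null (Finset.measure_zero _ _)]
      simp
    · rintro x ⟨hx, hxr⟩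
      refine ⟨?_, hx⟩
      have h0 : p.eval x ≠ 0 := by
        intro h
        exact hxr (by simpa [hp] using h)
      simp only [Function.mem_support, eval_mul]
      exact mul_ne_zero (mul_ne_zero h0 h0) (Real.rpow_pos_of_pos (one_sub_sq_pos hx) _).ne'
  · refine (ae_restrict_iff' measurableSet_Ioo).2 (Filter.Eventually.of_forall fun x hx => ?_)
    simp only [eval_mul, Pi.zero_apply]
    exact mul_nonneg (mul_self_nonneg _) (Real.rpow_pos_of_pos (one_sub_sq_pos hx) _).le

theorem isUltrasphericalFunctional_weightFunctional {α : ℝ} (hα : 0 < α) :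
    IsUltrasphericalFunctional α (weightFunctional hα) where
  pearson f := by
    have h := integral_deriv_eval_mul_ultraspherical (β := α + 1) (by linarith) f
    rw [← map_C_mul, ← sub_eq_zero, ← map_sub, weightFunctional_apply, ← h,
      ← setIntegral_Ioo_eq_intervalIntegral, ← setIntegral_Ioo_eq_intervalIntegral]
    refine setIntegral_congr_fun measurableSet_Ioo fun x hx => ?_
    have : ultraspherical (α + 1) x = (1 - x ^ 2) * ultraspherical α x := by
      simp only [ultraspherical]
      rw [Real.rpow_add_one (one_sub_sq_pos hx).ne', mul_comm]
    simp [this]; ring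
  even f := by
    rw [weightFunctional_apply, weightFunctional_apply]
    have := intervalIntegral.integral_comp_neg (a := -1) (b := 1)
      (fun x => f.eval x * ultraspherical α x)
    rw [neg_neg] at this
    rw [← this]
    simp [ultraspherical, eval_comp]

theorem isOrthonormalSeq_ultraspherical {α : ℝ} (hα : 0 < α) :
    IsOrthonormalSeq (weightFunctional hα) (orthoPoly (Set.Ioo (-1) 1) (ultraspherical α)) :=
  isOrthonormalSeq_orthoPoly (wInner_ultraspherical hα) fun _ => weightFunctional_mul_self_pos hα

theorem deriv_wFun_mul_wFun (α : ℝ) (m n : ℕ) {x : ℝ} (hx : x ∈ Set.Ioo (-1 : ℝ) 1) :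
    deriv (wFun (Set.Ioo (-1) 1) (ultraspherical α) m) x *
        wFun (Set.Ioo (-1) 1) (ultraspherical α) n x =
      (derivative (orthoPoly (Set.Ioo (-1) 1) (ultraspherical α) m) *
        orthoPoly (Set.Ioo (-1) 1) (ultraspherical α) n).eval x * ultraspherical α x +
      (C (-α) * X * (orthoPoly (Set.Ioo (-1) 1) (ultraspherical α) m *
        orthoPoly (Set.Ioo (-1) 1) (ultraspherical α) n)).eval x * ultraspherical (α - 1) x := by
  have hw : 0 < ultraspherical α x := Real.rpow_pos_of_pos (one_sub_sq_pos hx) _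
  have hd := ((hasDerivAt_ultraspherical α hx).sqrt hw.ne').mul
    ((orthoPoly (Set.Ioo (-1) 1) (ultraspherical α) m).hasDerivAt x)
  have hd' : deriv (wFun (Set.Ioo (-1) 1) (ultraspherical α) m) x = _ := hd.deriv
  rw [hd', wFun]
  have hs := Real.sqrt_pos.2 hw
  have hs2 := Real.sq_sqrt hw.le
  simp only [eval_mul, eval_C, eval_X]
  field_simp
  rw [hs2]
  ring

theorem entriesFinite_ultraspherical {α : ℝ} (hα : 0 < α) :
    EntriesFinite (Set.Ioo (-1) 1) (ultraspherical α) := by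
  intro m n
  refine IntegrableOn.congr_fun ((intervalIntegrable_iff_integrableOn_Ioo_of_le (by norm_num)).1
    ((intervalIntegrable_eval_mul_ultraspherical (γ := α) (by linarith) _).add
      (intervalIntegrable_eval_mul_ultraspherical (γ := α - 1) (by linarith) _)))
    (fun x hx => (deriv_wFun_mul_wFun α m n hx).symm) measurableSet_Ioo

/-- Twice the entry contains the same singular term as the vanishing integral of `(pₘ pₙ w)'`;
subtraction cancels it. -/
theorem two_mul_diffMatrix_ultraspherical {α : ℝ} (hα : 0 < α) (m n : ℕ) :
    2 * diffMatrix (Set.Ioo (-1) 1) (ultraspherical α) m n =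
      weightFunctional hα
        (derivative (orthoPoly (Set.Ioo (-1) 1) (ultraspherical α) m) *
          orthoPoly (Set.Ioo (-1) 1) (ultraspherical α) n -
        orthoPoly (Set.Ioo (-1) 1) (ultraspherical α) m *
          derivative (orthoPoly (Set.Ioo (-1) 1) (ultraspherical α) n)) := by
  set P := orthoPoly (Set.Ioo (-1) 1) (ultraspherical α) with hP
  have h := integral_deriv_eval_mul_ultraspherical hα (P m * P n)
  rw [weightFunctional_apply, ← sub_zero (∫ x in (-1 : ℝ)..1, _), diffMatrix,
    setIntegral_congr_fun measurableSet_Ioo fun x hx => deriv_wFun_mul_wFun α m n hx,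
    setIntegral_Ioo_eq_intervalIntegral, ← intervalIntegral.integral_const_mul, sub_zero,
    ← sub_eq_zero, ← intervalIntegral.integral_sub, ← h]
  · refine intervalIntegral.integral_congr fun x _ => ?_
    simp only [← hP, derivative_mul, eval_mul, eval_add, eval_sub, eval_C, eval_X]
    ring
  · exact ((intervalIntegrable_eval_mul_ultraspherical (γ := α) (by linarith) _).add
      (intervalIntegrable_eval_mul_ultraspherical (γ := α - 1) (by linarith) _)).const_mul _
  · exact intervalIntegrable_eval_mul_ultraspherical (γ := α) (by linarith) _

/-- The value at `1` of the `n`-th orthonormal ultraspherical polynomial. -/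
def endpointValue (α : ℝ) (n : ℕ) : ℝ :=
  (orthoPoly (Set.Ioo (-1) 1) (ultraspherical α) n).eval 1

theorem endpointValue_pos {α : ℝ} (hα : 0 < α) (n : ℕ) : 0 < endpointValue α n :=
  (isUltrasphericalFunctional_weightFunctional hα).eval_one_pos
    (isOrthonormalSeq_ultraspherical hα) hα n

theorem endpointValue_sq_succ {α : ℝ} (hα : 0 < α) (n : ℕ) :
    (n + 1) * (2 * n + 2 * α + 1) * endpointValue α (n + 1) ^ 2 =
      (2 * n + 2 * α + 3) * (n + 2 * α + 1) * endpointValue α n ^ 2 :=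
  (isUltrasphericalFunctional_weightFunctional hα).eval_one_sq_succ
    (isOrthonormalSeq_ultraspherical hα) n

theorem diffMatrix_ultraspherical_swap {α : ℝ} (hα : 0 < α) (m n : ℕ) :
    diffMatrix (Set.Ioo (-1) 1) (ultraspherical α) n m =
      -diffMatrix (Set.Ioo (-1) 1) (ultraspherical α) m n := by
  have h1 := two_mul_diffMatrix_ultraspherical hα m n
  have h2 := two_mul_diffMatrix_ultraspherical hα n m
  rw [← neg_sub, map_neg, mul_comm (derivative _), mul_comm _ (derivative _)] at h2
  linarith

theorem diffMatrix_ultraspherical_of_even {α : ℝ} (hα : 0 < α) {m n : ℕ} (h : Even (m + n)) :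
    diffMatrix (Set.Ioo (-1) 1) (ultraspherical α) m n = 0 := by
  have hp := isOrthonormalSeq_ultraspherical hα
  have hL := isUltrasphericalFunctional_weightFunctional hα
  have h0 := two_mul_diffMatrix_ultraspherical hα m n
  rw [map_eq_zero_of_odd hL.even] at h0
  · linarith
  have h1 : (C ((-1) ^ m) : ℝ[X]) * C ((-1) ^ n) = 1 := by
    rw [← C_mul, ← pow_add, h.neg_one_pow, C_1]
  simp only [sub_comp, mul_comp, hp.comp_neg_X hL.even, hL.derivative_comp_neg_X hp]
  set P := orthoPoly (Set.Ioo (-1) 1) (ultraspherical α)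
  linear_combination (-derivative (P m) * P n + P m * derivative (P n)) * h1

theorem diffMatrix_ultraspherical_of_lt {α : ℝ} (hα : 0 < α) {m n : ℕ} (hmn : m < n)
    (hodd : Odd (m + n)) :
    diffMatrix (Set.Ioo (-1) 1) (ultraspherical α) m n =
      -((n + α + 1 / 2) * (endpointValue α m / endpointValue α n)) := by
  have hp := isOrthonormalSeq_ultraspherical hα
  have hL := isUltrasphericalFunctional_weightFunctional hα
  have h0 := two_mul_diffMatrix_ultraspherical hα m n
  have h1 := hL.map_derivative_mul hp hα hmn hodd
  rw [map_sub, hp.map_mul_eq_zero, mul_comm (orthoPoly _ _ m), h1] at h0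
  · simp only [endpointValue]
    linarith
  · exact (degree_derivative_le).trans_lt (by rw [hp.degree_eq]; exact_mod_cast hmn)

end WFun

end

/-! ### Growth of the endpoint values and size of the entries. -/

noncomputable section

namespace WFun

open Filter Topology

theorem endpointValue_sq {α : ℝ} (hα : 0 < α) (n : ℕ) :
    endpointValue α n ^ 2 * ((2 * α + 1) * n.factorial) =
      endpointValue α 0 ^ 2 * (2 * n + (2 * α + 1)) * ∏ j ∈ Finset.range n, (2 * α + 1 + j) := by
  induction n with
  | zero => simp
  | succ n ih =>
    have h : (2 * n + 2 * α + 1 : ℝ) ≠ 0 := by positivity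
    rw [Finset.prod_range_succ, Nat.factorial_succ]
    push_cast
    apply mul_left_cancel₀ h
    linear_combination (2 * α + 1) * n.factorial * endpointValue_sq_succ hα n +
      (2 * n + 2 * α + 3) * (n + 2 * α + 1) * ih

theorem exists_pos_bounds_of_tendsto {u : ℕ → ℝ} {l : ℝ} (hu : ∀ n, 0 < u n) (hl : 0 < l)
    (h : Tendsto u atTop (𝓝 l)) : ∃ c > 0, ∃ C > 0, ∀ n, c ≤ u n ∧ u n ≤ C := by
  obtain ⟨C, hC⟩ := h.bddAbove_range
  obtain ⟨K, hK⟩ := (h.inv₀ hl.ne').bddAbove_range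
  have hC' : ∀ n, u n ≤ C := fun n => hC ⟨n, rfl⟩
  have hK' : ∀ n, (u n)⁻¹ ≤ K := fun n => hK ⟨n, rfl⟩
  refine ⟨K⁻¹, inv_pos.2 ((inv_pos.2 (hu 0)).trans_le (hK' 0)), C, (hu 0).trans_le (hC' 0),
    fun n => ⟨?_, hC' n⟩⟩
  exact inv_le_of_inv_le₀ (hu n) (hK' n)

theorem tendsto_endpointValue_sq_div {α : ℝ} (hα : 0 < α) :
    Tendsto (fun n : ℕ => endpointValue α n ^ 2 / ((n : ℝ) + 1) ^ (2 * α + 1)) atTop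
      (𝓝 (endpointValue α 0 ^ 2 / (2 * α + 1) * (1 + 1) * 1 ^ (2 * α + 1) /
        Real.Gamma (2 * α + 1))) := by
  set s := 2 * α + 1 with hs
  have hs0 : 0 < s := by positivity
  have hG := Real.GammaSeq_tendsto_Gamma s
  have h1 := tendsto_natCast_div_add_atTop (𝕜 := ℝ) s
  have h2 := (tendsto_natCast_div_add_atTop (𝕜 := ℝ) 1).rpow_const (p := s) (Or.inr hs0.le)
  -- The factor `1 + 1` is the limit of `(2n + s) / (n + s) = 1 + n / (n + s)`, and `1 ^ s` that of
  -- `(n / (n + 1)) ^ s`; the remaining product is the reciprocal of `Real.GammaSeq`.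
  refine Tendsto.congr' ?_ ((((h1.const_add 1).const_mul (endpointValue α 0 ^ 2 / s)).mul h2).div
    hG (Real.Gamma_pos_of_pos hs0).ne')
  filter_upwards [eventually_gt_atTop 0] with n hn
  have hn' : (0 : ℝ) < n := by exact_mod_cast hn
  have he := endpointValue_sq hα n
  rw [← hs] at he
  have hP : 0 < ∏ j ∈ Finset.range n, (s + j) := Finset.prod_pos fun j _ => by positivity
  have hf : (0 : ℝ) < n.factorial := by exact_mod_cast n.factorial_pos
  have hns := Real.rpow_pos_of_pos hn' s
  have hns1 := Real.rpow_pos_of_pos (by positivity : (0 : ℝ) < n + 1) s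
  have he' : endpointValue α n ^ 2 = endpointValue α 0 ^ 2 * (2 * n + s) *
      (∏ j ∈ Finset.range n, (s + j)) / (s * n.factorial) := by
    rw [eq_div_iff (by positivity), he]
  have hg : Real.GammaSeq s n =
    (n : ℝ) ^ s * n.factorial / ∏ j ∈ Finset.range (n + 1), (s + j) := rfl
  simp only [Pi.div_apply]
  rw [he', hg, Finset.prod_range_succ, Real.div_rpow hn'.le (by positivity)]
  field_simp
  ring

/-- The endpoint values of the orthonormal ultraspherical polynomials grow like `n ^ (α + 1/2)`. -/
theorem exists_endpointValue_bounds {α : ℝ} (hα : 0 < α) :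
    ∃ c > 0, ∃ C > 0, ∀ n : ℕ, c * ((n : ℝ) + 1) ^ (α + 1 / 2) ≤ endpointValue α n ∧
      endpointValue α n ≤ C * ((n : ℝ) + 1) ^ (α + 1 / 2) := by
  have hpow : ∀ n : ℕ, 0 < ((n : ℝ) + 1) ^ (α + 1 / 2) := fun n =>
    Real.rpow_pos_of_pos (by positivity) _
  have h := (tendsto_endpointValue_sq_div hα).sqrt
  have hu : ∀ n : ℕ, √(endpointValue α n ^ 2 / ((n : ℝ) + 1) ^ (2 * α + 1)) =
      endpointValue α n / ((n : ℝ) + 1) ^ (α + 1 / 2) := by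
    intro n
    rw [show 2 * α + 1 = (α + 1 / 2) * (2 : ℕ) by push_cast; ring,
      Real.rpow_mul_natCast (by positivity), ← div_pow,
      Real.sqrt_sq (div_nonneg (endpointValue_pos hα n).le (hpow n).le)]
  simp only [hu] at h
  obtain ⟨c, hc, C, hC, hb⟩ := exists_pos_bounds_of_tendsto
    (fun n => div_pos (endpointValue_pos hα n) (hpow n)) (Real.sqrt_pos.2 (by
      have := endpointValue_pos hα 0
      have := Real.Gamma_pos_of_pos (by positivity : 0 < 2 * α + 1)
      rw [Real.one_rpow]
      positivity)) h
  exact ⟨c, hc, C, hC, fun n => ⟨(le_div_iff₀ (hpow n)).1 (hb n).1,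
    (div_le_iff₀ (hpow n)).1 (hb n).2⟩⟩

theorem abs_diffMatrix_ultraspherical_of_lt {α : ℝ} (hα : 0 < α) {m n : ℕ} (hmn : m < n)
    (hodd : Odd (m + n)) :
    |diffMatrix (Set.Ioo (-1) 1) (ultraspherical α) m n| =
      (n + α + 1 / 2) * (endpointValue α m / endpointValue α n) := by
  rw [diffMatrix_ultraspherical_of_lt hα hmn hodd, abs_neg, abs_of_nonneg]
  have h1 := endpointValue_pos hα m
  have h2 := endpointValue_pos hα n
  positivity

theorem abs_diffMatrix_ultraspherical_comm {α : ℝ} (hα : 0 < α) (m n : ℕ) :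
    |diffMatrix (Set.Ioo (-1) 1) (ultraspherical α) m n| =
      |diffMatrix (Set.Ioo (-1) 1) (ultraspherical α) n m| := by
  rw [diffMatrix_ultraspherical_swap hα n m, abs_neg]

theorem mul_rpow_neg_self {x : ℝ} (hx : 0 < x) (a : ℝ) : x * x ^ (-a) = x ^ (1 - a) := by
  rw [sub_eq_add_neg, Real.rpow_add hx, Real.rpow_one]

theorem exists_diffMatrix_upper {α : ℝ} (hα : 0 < α) :
    ∃ C > 0, ∀ m n : ℕ, |diffMatrix (Set.Ioo (-1) 1) (ultraspherical α) m n| ≤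
      C * (((min m n : ℕ) : ℝ) + 1) ^ (α + 1 / 2) *
        (((max m n : ℕ) : ℝ) + 1) ^ (1 - (α + 1 / 2)) := by
  obtain ⟨c, hc, C, hC, hb⟩ := exists_endpointValue_bounds hα
  have hpow : ∀ (n : ℕ) (t : ℝ), 0 < ((n : ℝ) + 1) ^ t := fun n t =>
    Real.rpow_pos_of_pos (by positivity) _
  have key : ∀ m n : ℕ, m < n → |diffMatrix (Set.Ioo (-1) 1) (ultraspherical α) m n| ≤
      (α + 1) * C / c * ((m : ℝ) + 1) ^ (α + 1 / 2) * ((n : ℝ) + 1) ^ (1 - (α + 1 / 2)) := by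
    intro m n hmn
    rcases Nat.even_or_odd (m + n) with he | ho
    · rw [diffMatrix_ultraspherical_of_even hα he, abs_zero]
      have := hpow m (α + 1 / 2)
      have := hpow n (1 - (α + 1 / 2))
      positivity
    · rw [abs_diffMatrix_ultraspherical_of_lt hα hmn ho]
      have h1 : endpointValue α m / endpointValue α n ≤
          (C * ((m : ℝ) + 1) ^ (α + 1 / 2)) / (c * ((n : ℝ) + 1) ^ (α + 1 / 2)) :=
        div_le_div₀ (mul_pos hC (hpow _ _)).le (hb m).2 (mul_pos hc (hpow _ _)) (hb n).1
      have h2 : (n : ℝ) + α + 1 / 2 ≤ (α + 1) * (n + 1) := by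
        have : 0 ≤ α * (n : ℝ) := by positivity
        linarith
      refine (mul_le_mul h2 h1 (div_nonneg (endpointValue_pos hα m).le
        (endpointValue_pos hα n).le) (by positivity)).trans (le_of_eq ?_)
      rw [← mul_rpow_neg_self (by positivity : (0 : ℝ) < n + 1), Real.rpow_neg (by positivity)]
      have := (hpow n (α + 1 / 2)).ne'
      field_simp
  refine ⟨(α + 1) * C / c, by positivity, fun m n => ?_⟩
  rcases lt_trichotomy m n with h | rfl | h
  · rw [min_eq_left h.le, max_eq_right h.le]
    exact key m n h
  · rw [diffMatrix_ultraspherical_of_even hα ⟨m, rfl⟩, abs_zero, min_self, max_self]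
    have := hpow m (α + 1 / 2)
    have := hpow m (1 - (α + 1 / 2))
    positivity
  · rw [min_eq_right h.le, max_eq_left h.le, abs_diffMatrix_ultraspherical_comm hα]
    exact key n m h

theorem exists_diffMatrix_lower {α : ℝ} (hα : 0 < α) :
    ∃ c > 0, ∀ m n : ℕ, m < n → Odd (m + n) →
      c * ((m : ℝ) + 1) ^ (α + 1 / 2) * ((n : ℝ) + 1) ^ (1 - (α + 1 / 2)) ≤
        |diffMatrix (Set.Ioo (-1) 1) (ultraspherical α) m n| := by
  obtain ⟨c, hc, C, hC, hb⟩ := exists_endpointValue_bounds hα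
  have hpow : ∀ (n : ℕ) (t : ℝ), 0 < ((n : ℝ) + 1) ^ t := fun n t =>
    Real.rpow_pos_of_pos (by positivity) _
  refine ⟨1 / 2 * c / C, by positivity, fun m n hmn ho => ?_⟩
  rw [abs_diffMatrix_ultraspherical_of_lt hα hmn ho]
  have h1 : (c * ((m : ℝ) + 1) ^ (α + 1 / 2)) / (C * ((n : ℝ) + 1) ^ (α + 1 / 2)) ≤
      endpointValue α m / endpointValue α n :=
    div_le_div₀ (endpointValue_pos hα m).le (hb m).1 (endpointValue_pos hα n) (hb n).2
  have h2 : 1 / 2 * ((n : ℝ) + 1) ≤ (n : ℝ) + α + 1 / 2 := by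
    have : 0 ≤ (n : ℝ) := by positivity
    linarith
  have h3 := hpow m (α + 1 / 2)
  have h4 := hpow n (α + 1 / 2)
  refine (le_of_eq ?_).trans (mul_le_mul h2 h1 (by positivity) (by positivity))
  rw [← mul_rpow_neg_self (by positivity : (0 : ℝ) < n + 1), Real.rpow_neg (by positivity)]
  field_simp

end WFun

end

/-! ### Convergence and divergence of path sums for entries of order `min ^ a * max ^ (1 - a)`. -/

noncomputable section

namespace WFun

open scoped ENNReal

/-- The sum of the absolute values of the path products, as an extended nonnegative real. -/
def pathSum (D : ℕ → ℕ → ℝ) (r m n : ℕ) : ℝ≥0∞ :=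
  ∑' κ : Fin r → ℕ, ENNReal.ofReal |pathProd D r κ m n|

theorem summable_iff_pathSum_ne_top (D : ℕ → ℕ → ℝ) (r m n : ℕ) :
    (Summable fun κ : Fin r → ℕ => pathProd D r κ m n) ↔ pathSum D r m n ≠ ∞ := by
  rw [← summable_abs_iff]
  constructor
  · intro h
    rw [pathSum, ← ENNReal.ofReal_tsum_of_nonneg (fun _ => abs_nonneg _) h]
    exact ENNReal.ofReal_ne_top
  · intro h
    simpa [ENNReal.toReal_ofReal] using ENNReal.summable_toReal h

theorem pathSum_zero (D : ℕ → ℕ → ℝ) (m n : ℕ) :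
    pathSum D 0 m n = ENNReal.ofReal |D m n| := by
  rw [pathSum, tsum_fintype]
  simp [pathProd]

theorem pathSum_succ (D : ℕ → ℕ → ℝ) (r m n : ℕ) :
    pathSum D (r + 1) m n = ∑' j, ENNReal.ofReal |D m j| * pathSum D r j n := by
  rw [pathSum, ← (Fin.consEquiv fun _ => ℕ).tsum_eq, ENNReal.tsum_prod']
  refine tsum_congr fun j => ?_
  rw [pathSum, ← ENNReal.tsum_mul_left]
  refine tsum_congr fun κ => ?_
  rw [← ENNReal.ofReal_mul (abs_nonneg _), ← abs_mul]
  simp [pathProd, Fin.consEquiv]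

theorem min_rpow_mul_max_rpow_le {a : ℝ} (ha : 1 / 2 ≤ a) {x y : ℝ} (hx : 0 < x) (hy : 0 < y) :
    (min x y) ^ a * (max x y) ^ (1 - a) ≤ y ^ a * x ^ (1 - a) := by
  rcases le_total x y with h | h
  · rw [min_eq_left h, max_eq_right h]
    have h1 : x ^ (2 * a - 1) ≤ y ^ (2 * a - 1) :=
      Real.rpow_le_rpow hx.le h (by linarith)
    have h2 : x ^ a = x ^ (2 * a - 1) * x ^ (1 - a) := by
      rw [← Real.rpow_add hx]; ring_nf
    have h3 : y ^ a = y ^ (2 * a - 1) * y ^ (1 - a) := by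
      rw [← Real.rpow_add hy]; ring_nf
    rw [h2, h3]
    have h4 := Real.rpow_pos_of_pos hx (1 - a)
    have h5 := Real.rpow_pos_of_pos hy (1 - a)
    nlinarith [mul_pos h4 h5]
  · rw [min_eq_right h, max_eq_left h]

/-- One summation step: `x` is the free index, `y` the summed one. The loss of `ε` buys the summable
factor `y ^ (-1 - ε)` uniformly; `2 + t + ε ≤ 2 * a` controls the tail `y ≥ x`. -/
theorem min_rpow_mul_max_rpow_mul_le {a ε t : ℝ} (ht : 0 ≤ 1 + ε + t)
    (h : 2 + t + ε ≤ 2 * a) {x y : ℝ} (hx : 0 < x) (hy : 0 < y) :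
    (min x y) ^ a * (max x y) ^ (1 - a) * y ^ (t - a) ≤
      x ^ (2 + t + ε - a) * y ^ (-1 - ε) := by
  have hyp := Real.rpow_pos_of_pos hy (-1 - ε)
  rcases le_total y x with hyx | hxy
  · rw [min_eq_right hyx, max_eq_left hyx]
    have h1 : y ^ a * x ^ (1 - a) * y ^ (t - a) = y ^ (1 + ε + t) * x ^ (1 - a) * y ^ (-1 - ε) := by
      rw [mul_right_comm, ← Real.rpow_add hy, mul_right_comm, ← Real.rpow_add hy]
      ring_nf
    have h2 : x ^ (2 + t + ε - a) = x ^ (1 + ε + t) * x ^ (1 - a) := by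
      rw [← Real.rpow_add hx]; ring_nf
    rw [h1, h2]
    have := Real.rpow_pos_of_pos hx (1 - a)
    gcongr
  · rw [min_eq_left hxy, max_eq_right hxy]
    have h1 : x ^ a * y ^ (1 - a) * y ^ (t - a) =
        x ^ a * y ^ (2 + t + ε - 2 * a) * y ^ (-1 - ε) := by
      rw [mul_assoc, mul_assoc, ← Real.rpow_add hy, ← Real.rpow_add hy]
      ring_nf
    have h2 : x ^ (2 + t + ε - a) = x ^ a * x ^ (2 + t + ε - 2 * a) := by
      rw [← Real.rpow_add hx]; ring_nf
    rw [h1, h2]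
    have h3 : y ^ (2 + t + ε - 2 * a) ≤ x ^ (2 + t + ε - 2 * a) :=
      Real.rpow_le_rpow_of_nonpos hx hxy (by linarith)
    have := Real.rpow_pos_of_pos hx a
    gcongr

theorem summable_add_one_rpow {ε : ℝ} (hε : 0 < ε) :
    Summable fun j : ℕ => ((j : ℝ) + 1) ^ (-1 - ε) := by
  have := (summable_nat_add_iff 1).2 (Real.summable_nat_rpow.2 (by linarith : -1 - ε < -1))
  simpa using this

/-- Induction on `r`, splitting off the first intermediate index: each step raises the exponent of
the free index by `2 + ε`. -/
theorem exists_pathSum_le {D : ℕ → ℕ → ℝ} {a C : ℝ} (hC : 0 ≤ C) (ha : 1 / 2 ≤ a)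
    (hD : ∀ m n : ℕ, |D m n| ≤
      C * (((min m n : ℕ) : ℝ) + 1) ^ a * (((max m n : ℕ) : ℝ) + 1) ^ (1 - a))
    {ε : ℝ} (hε : 0 < ε) (n r : ℕ) (hr : 2 * r + 1 + ε * r ≤ 2 * a) :
    ∃ K : ℝ, 0 ≤ K ∧ ∀ m : ℕ, pathSum D r m n ≤
      ENNReal.ofReal (K * ((m : ℝ) + 1) ^ (2 * r + 1 + ε * r - a)) := by
  have hD' : ∀ m n : ℕ, |D m n| ≤
      C * ((min ((m : ℝ) + 1) (n + 1)) ^ a * (max ((m : ℝ) + 1) (n + 1)) ^ (1 - a)) := by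
    intro m n
    rw [min_add_add_right, max_add_add_right, ← mul_assoc]
    exact_mod_cast hD m n
  induction r with
  | zero =>
    refine ⟨C * ((n : ℝ) + 1) ^ a, by positivity, fun m => ?_⟩
    rw [pathSum_zero]
    apply ENNReal.ofReal_le_ofReal
    have := mul_le_mul_of_nonneg_left
      (min_rpow_mul_max_rpow_le ha (by positivity : (0 : ℝ) < m + 1)
        (by positivity : (0 : ℝ) < n + 1)) hC
    refine (hD' m n).trans (this.trans (le_of_eq ?_))
    simp [mul_assoc]
  | succ r ih =>
    push_cast at hr
    obtain ⟨K, hK, hb⟩ := ih (by nlinarith)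
    have hs := summable_add_one_rpow hε
    refine ⟨C * K * ∑' j : ℕ, ((j : ℝ) + 1) ^ (-1 - ε),
      mul_nonneg (mul_nonneg hC hK) (tsum_nonneg fun _ => by positivity), fun m => ?_⟩
    have key : ∀ j : ℕ, ENNReal.ofReal |D m j| * pathSum D r j n ≤
        ENNReal.ofReal (C * K * ((m : ℝ) + 1) ^ (2 * (r + 1 : ℕ) + 1 + ε * (r + 1 : ℕ) - a) *
          ((j : ℝ) + 1) ^ (-1 - ε)) := by
      intro j
      refine (mul_le_mul_right (hb j) _).trans ?_
      rw [← ENNReal.ofReal_mul (abs_nonneg _)]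
      apply ENNReal.ofReal_le_ofReal
      have h1 := min_rpow_mul_max_rpow_mul_le (a := a) (ε := ε) (t := 2 * r + 1 + ε * r)
        (by positivity) (by linarith) (by positivity : (0 : ℝ) < m + 1)
        (by positivity : (0 : ℝ) < j + 1)
      calc |D m j| * (K * ((j : ℝ) + 1) ^ (2 * r + 1 + ε * r - a))
          ≤ C * ((min ((m : ℝ) + 1) (j + 1)) ^ a * (max ((m : ℝ) + 1) (j + 1)) ^ (1 - a)) *
            (K * ((j : ℝ) + 1) ^ (2 * r + 1 + ε * r - a)) := by
              gcongr; exact hD' m j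
        _ = C * K * ((min ((m : ℝ) + 1) (j + 1)) ^ a * (max ((m : ℝ) + 1) (j + 1)) ^ (1 - a) *
            ((j : ℝ) + 1) ^ (2 * r + 1 + ε * r - a)) := by ring
        _ ≤ C * K * (((m : ℝ) + 1) ^ (2 + (2 * r + 1 + ε * r) + ε - a) *
            ((j : ℝ) + 1) ^ (-1 - ε)) := by gcongr
        _ = _ := by
          rw [← mul_assoc]
          congr 3
          push_cast; ring
    rw [pathSum_succ]
    refine (ENNReal.tsum_le_tsum key).trans (le_of_eq ?_)
    rw [← ENNReal.ofReal_tsum_of_nonneg (fun _ => by positivity) (hs.mul_left _), tsum_mul_left]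
    congr 1; ring

theorem powerBounded_of_abs_le {D : ℕ → ℕ → ℝ} {a C : ℝ} (hC : 0 ≤ C)
    (hD : ∀ m n : ℕ, |D m n| ≤
      C * (((min m n : ℕ) : ℝ) + 1) ^ a * (((max m n : ℕ) : ℝ) + 1) ^ (1 - a))
    {k : ℕ} (hk : (k : ℝ) - 1 / 2 < a) : PowerBounded D k := by
  cases k with
  | zero => trivial
  | succ r =>
    intro m n
    rw [summable_iff_pathSum_ne_top]
    push_cast at hk
    -- The slack `2 * a - 2 * r - 1` is spread over `r + 1` shares, of which the `r` summations use
    -- `r`.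
    have hε : 0 < (2 * a - 2 * r - 1) / (r + 1) := div_pos (by linarith) (by positivity)
    have hr : (0 : ℝ) ≤ r := by positivity
    have hle : (2 * a - 2 * r - 1) / (r + 1) * r ≤ 2 * a - 2 * r - 1 := by
      rw [div_mul_eq_mul_div, div_le_iff₀ (by positivity)]
      nlinarith
    obtain ⟨K, -, hb⟩ := exists_pathSum_le hC (by linarith) hD hε n r (by linarith)
    exact ne_top_of_le_ne_top ENNReal.ofReal_ne_top (hb m)

theorem pow_le_mul_sum_range_pow (d n : ℕ) :
    (n : ℝ) ^ (d + 1) ≤ (d + 1) * ∑ p ∈ Finset.range n, ((p : ℝ) + 1) ^ d := by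
  induction n with
  | zero => simp
  | succ n ih =>
    rw [Finset.sum_range_succ, mul_add]
    have h1 : ((n : ℝ) + 1) ^ (d + 1) - (n : ℝ) ^ (d + 1) ≤ (d + 1) * ((n : ℝ) + 1) ^ d := by
      have h2 := one_add_mul_le_pow (a := -(1 / ((n : ℝ) + 1))) (by
        have : 1 / ((n : ℝ) + 1) ≤ 1 := by
          rw [div_le_one (by positivity)]; linarith [(n.cast_nonneg : (0 : ℝ) ≤ n)]
        linarith) (d + 1)
      have h3 : 1 + -(1 / ((n : ℝ) + 1)) = n / (n + 1) := by field_simp; ring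
      rw [h3, div_pow, le_div_iff₀ (by positivity)] at h2
      have h4 : (1 + ((d + 1 : ℕ) : ℝ) * -(1 / ((n : ℝ) + 1))) * ((n : ℝ) + 1) ^ (d + 1) =
          ((n : ℝ) + 1) ^ (d + 1) - (d + 1) * ((n : ℝ) + 1) ^ d := by
        push_cast; field_simp; ring
      linarith
    push_cast
    linarith

/-- Writing `y ^ (1 - a) = y * y ^ (-a)` gives a bound whatever the sign of `1 - a`, so comparable
indices may be exchanged. -/
theorem rpow_neg_mul_rpow_le {a K x y : ℝ} (ha : 0 ≤ a) (hx : 0 < x) (hxy : x ≤ y) (hK : 0 < K)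
    (hyx : y ≤ K * x) : K ^ (-a) * x ^ (1 - a) ≤ y ^ (1 - a) := by
  have hy := hx.trans_le hxy
  rw [← mul_rpow_neg_self hx, ← mul_rpow_neg_self hy, mul_left_comm,
    ← Real.mul_rpow hK.le hx.le]
  have h1 : (K * x) ^ (-a) ≤ y ^ (-a) := Real.rpow_le_rpow_of_nonpos hy hyx (by linarith)
  have h2 := Real.rpow_pos_of_pos (mul_pos hK hx) (-a)
  gcongr

section Lower

variable {D : ℕ → ℕ → ℝ} {a c : ℝ}

/-- Keep only paths whose next index is `r + 1 + 2 * p` with `p ≤ q`, below the current one and of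
opposite parity. The powers `a` and `1 - a` of `p + 1` combine, and `∑ (p + 1) ^ (2 * r + 1)` gains
two powers of `q + 1`. -/
theorem exists_le_pathSum (hc : 0 < c) (ha : 0 ≤ a) (hsymm : ∀ m n, |D m n| = |D n m|)
    (hD : ∀ m n : ℕ, m < n → Odd (m + n) →
      c * ((m : ℝ) + 1) ^ a * ((n : ℝ) + 1) ^ (1 - a) ≤ |D m n|) (r : ℕ) :
    ∃ K > 0, ∀ q : ℕ, ENNReal.ofReal (K * (((q : ℝ) + 1) ^ (1 - a) * ((q : ℝ) + 1) ^ (2 * r))) ≤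
      pathSum D r (r + 1 + 2 * q) 0 := by
  induction r with
  | zero =>
    refine ⟨c * 2 ^ (-a), by positivity, fun q => ?_⟩
    rw [pathSum_zero]
    apply ENNReal.ofReal_le_ofReal
    rw [hsymm]
    refine le_trans ?_ (hD 0 (0 + 1 + 2 * q) (by omega) ⟨q, by ring⟩)
    have := rpow_neg_mul_rpow_le (K := 2) ha (by positivity : (0 : ℝ) < q + 1)
      (by linarith : (q : ℝ) + 1 ≤ 2 * (q + 1)) (by norm_num) le_rfl
    push_cast
    rw [show (1 : ℝ) + 2 * q + 1 = 2 * (q + 1) by ring]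
    simp only [pow_zero, mul_one, zero_add, Real.one_rpow, mul_assoc]
    gcongr
  | succ r ih =>
    obtain ⟨K, hK, hb⟩ := ih
    refine ⟨c * ((r : ℝ) + 3) ^ (-a) * K / ((2 * r + 1 : ℕ) + 1), by positivity, fun q => ?_⟩
    rw [pathSum_succ]
    have hinj : Function.Injective fun p : ℕ => r + 1 + 2 * p := fun x y h => by
      simpa using h
    refine le_trans ?_ (ENNReal.tsum_comp_le_tsum_of_injective hinj _)
    refine le_trans ?_ (ENNReal.sum_le_tsum (Finset.range (q + 1)))
    have key : ∀ p ∈ Finset.range (q + 1),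
        ENNReal.ofReal (c * ((r : ℝ) + 3) ^ (-a) * K * ((q : ℝ) + 1) ^ (1 - a) *
          ((p : ℝ) + 1) ^ (2 * r + 1)) ≤
        ENNReal.ofReal |D (r + 1 + 1 + 2 * q) (r + 1 + 2 * p)| *
          pathSum D r (r + 1 + 2 * p) 0 := by
      intro p hp
      have hpq : p ≤ q := Nat.lt_succ_iff.1 (Finset.mem_range.1 hp)
      refine le_trans ?_ (mul_le_mul_right (hb p) _)
      rw [← ENNReal.ofReal_mul (abs_nonneg _)]
      apply ENNReal.ofReal_le_ofReal
      have h1 := hD (r + 1 + 2 * p) (r + 1 + 1 + 2 * q) (by omega) ⟨r + 1 + p + q, by ring⟩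
      rw [hsymm] at h1
      have hr : (0 : ℝ) ≤ r := by positivity
      have hrq : (0 : ℝ) ≤ r * q := by positivity
      have hq : (0 : ℝ) ≤ q := by positivity
      have hp0 : (0 : ℝ) ≤ p := by positivity
      have h2 := rpow_neg_mul_rpow_le (K := (r : ℝ) + 3) (y := ((r + 1 + 1 + 2 * q : ℕ) : ℝ) + 1)
        ha (by positivity : (0 : ℝ) < q + 1) (by push_cast; linarith) (by positivity)
        (by push_cast; nlinarith)
      have h3 : ((p : ℝ) + 1) ^ a ≤ (((r + 1 + 2 * p : ℕ) : ℝ) + 1) ^ a :=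
        Real.rpow_le_rpow (by positivity) (by push_cast; linarith) ha
      have h4 : ((p : ℝ) + 1) ^ (2 * r + 1) =
          ((p : ℝ) + 1) ^ a * ((p : ℝ) + 1) ^ (1 - a) * ((p : ℝ) + 1) ^ (2 * r) := by
        rw [← Real.rpow_add (by positivity), add_sub_cancel, Real.rpow_one]; ring
      calc c * ((r : ℝ) + 3) ^ (-a) * K * ((q : ℝ) + 1) ^ (1 - a) * ((p : ℝ) + 1) ^ (2 * r + 1)
          = (c * ((p : ℝ) + 1) ^ a * (((r : ℝ) + 3) ^ (-a) * ((q : ℝ) + 1) ^ (1 - a))) *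
            (K * (((p : ℝ) + 1) ^ (1 - a) * ((p : ℝ) + 1) ^ (2 * r))) := by rw [h4]; ring
        _ ≤ _ := by
          refine mul_le_mul_of_nonneg_right (le_trans ?_ h1) (by positivity)
          gcongr
    refine le_trans ?_ (Finset.sum_le_sum key)
    rw [← ENNReal.ofReal_sum_of_nonneg (fun _ _ => by positivity)]
    apply ENNReal.ofReal_le_ofReal
    rw [← Finset.mul_sum]
    have h5 := pow_le_mul_sum_range_pow (2 * r + 1) (q + 1)
    rw [show 2 * (r + 1) = 2 * r + 1 + 1 by ring]
    push_cast at h5 ⊢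
    rw [div_mul_eq_mul_div, div_le_iff₀ (by positivity)]
    calc _ = c * ((r : ℝ) + 3) ^ (-a) * K * ((q : ℝ) + 1) ^ (1 - a) *
          ((q : ℝ) + 1) ^ (2 * r + 1 + 1) := by ring
      _ ≤ c * ((r : ℝ) + 3) ^ (-a) * K * ((q : ℝ) + 1) ^ (1 - a) *
          ((2 * r + 1 + 1) * ∑ p ∈ Finset.range (q + 1), ((p : ℝ) + 1) ^ (2 * r + 1)) := by gcongr
      _ = _ := by ring

theorem not_powerBounded_of_le_abs (hc : 0 < c) (ha : 0 ≤ a) (hsymm : ∀ m n, |D m n| = |D n m|)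
    (hD : ∀ m n : ℕ, m < n → Odd (m + n) →
      c * ((m : ℝ) + 1) ^ a * ((n : ℝ) + 1) ^ (1 - a) ≤ |D m n|) {k : ℕ} (hk : 2 ≤ k)
    (hak : a ≤ (k : ℝ) - 1 / 2) : ¬ PowerBounded D k := by
  obtain ⟨r, rfl⟩ : ∃ r, k = r + 1 + 1 := ⟨k - 2, by omega⟩
  intro h
  obtain ⟨K, hK, hb⟩ := exists_le_pathSum hc ha hsymm hD r
  -- The entry `(r, 0)` diverges: every `r + 1 + 2 * p` lies above `r` with opposite parity, so
  -- paths may jump up there and then return to `0`. Their total is at least a constant times `1 /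
  -- (p + 1)`.
  have hfin := (summable_iff_pathSum_ne_top _ _ _ _).1 (h r 0)
  rw [pathSum_succ] at hfin
  have hinj : Function.Injective fun p : ℕ => r + 1 + 2 * p := fun x y h => by
    simpa using h
  have hfin' := ne_top_of_le_ne_top hfin (ENNReal.tsum_comp_le_tsum_of_injective hinj _)
  have key : ∀ p : ℕ, ENNReal.ofReal (c * ((r : ℝ) + 2) ^ (-a) * K * (1 / ((p : ℝ) + 1))) ≤
      ENNReal.ofReal |D r (r + 1 + 2 * p)| * pathSum D r (r + 1 + 2 * p) 0 := by
    intro p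
    refine le_trans ?_ (mul_le_mul_right (hb p) _)
    rw [← ENNReal.ofReal_mul (abs_nonneg _)]
    apply ENNReal.ofReal_le_ofReal
    have h1 := hD r (r + 1 + 2 * p) (by omega) ⟨r + p, by ring⟩
    have hr : (0 : ℝ) ≤ r := by positivity
    have hrq : (0 : ℝ) ≤ r * p := by positivity
    have hp0 : (0 : ℝ) ≤ p := by positivity
    have h2 := rpow_neg_mul_rpow_le (K := (r : ℝ) + 2) (y := ((r + 1 + 2 * p : ℕ) : ℝ) + 1)
      ha (by positivity : (0 : ℝ) < p + 1) (by push_cast; linarith) (by positivity)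
      (by push_cast; nlinarith)
    have h3 : 1 ≤ ((r : ℝ) + 1) ^ a := Real.one_le_rpow (by linarith) ha
    have h4 : 1 / ((p : ℝ) + 1) ≤
        ((p : ℝ) + 1) ^ (1 - a) * (((p : ℝ) + 1) ^ (1 - a) * ((p : ℝ) + 1) ^ (2 * r)) := by
      rw [← Real.rpow_natCast, ← Real.rpow_add (by positivity), ← Real.rpow_add (by positivity),
        one_div, ← Real.rpow_neg_one]
      apply Real.rpow_le_rpow_of_exponent_le (by linarith)
      push_cast at hak ⊢
      linarith
    calc c * ((r : ℝ) + 2) ^ (-a) * K * (1 / ((p : ℝ) + 1))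
        ≤ c * ((r : ℝ) + 2) ^ (-a) * K *
          (((p : ℝ) + 1) ^ (1 - a) * (((p : ℝ) + 1) ^ (1 - a) * ((p : ℝ) + 1) ^ (2 * r))) := by
            gcongr
      _ = (c * 1 * (((r : ℝ) + 2) ^ (-a) * ((p : ℝ) + 1) ^ (1 - a))) *
          (K * (((p : ℝ) + 1) ^ (1 - a) * ((p : ℝ) + 1) ^ (2 * r))) := by ring
      _ ≤ _ := by
        refine mul_le_mul_of_nonneg_right (le_trans ?_ h1) (by positivity)
        gcongr
  have hs := ENNReal.summable_toReal (ne_top_of_le_ne_top hfin' (ENNReal.tsum_le_tsum key))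
  have hs' : Summable fun p : ℕ => c * ((r : ℝ) + 2) ^ (-a) * K * (1 / ((p : ℝ) + 1)) :=
    hs.congr fun p => ENNReal.toReal_ofReal (by positivity)
  rw [summable_mul_left_iff (by positivity)] at hs'
  exact Real.not_summable_one_div_natCast ((summable_nat_add_iff 1).1 (by exact_mod_cast hs'))

end Lower

/-- If the condition fails at `k`, every admissible bound is below `k`, so the supremum is at most
`k - 1`. -/
theorem natCast_le_index_iff (I : Set ℝ) (w : ℝ → ℝ) (s : ℕ) :
    (s : ℕ∞) ≤ index I w ↔
      ∀ k : ℕ, 1 ≤ k → k ≤ s → EntriesFinite I w ∧ PowerBounded (diffMatrix I w) k := by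
  constructor
  · intro h k hk hks
    by_contra hcon
    have hle : index I w ≤ ((k - 1 : ℕ) : ℕ∞) := by
      refine sSup_le fun t ht => ?_
      by_contra hlt
      refine hcon (ht k hk ?_)
      have := Order.add_one_le_of_lt (not_le.1 hlt)
      exact_mod_cast (show ((k - 1 + 1 : ℕ) : ℕ∞) ≤ t by exact_mod_cast this).trans' (by
        rw [Nat.sub_add_cancel hk])
    have h1 : s ≤ k - 1 := by exact_mod_cast h.trans hle
    omega
  · intro h
    exact le_sSup fun k hk hks => h k hk (by exact_mod_cast hks)

end WFun

end

theorem theorem8 (α : ℝ) (hα : 0 < α) (s : ℕ) (hs : 1 ≤ s) :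
    (s : ℕ∞) ≤ WFun.index (Set.Ioo (-1 : ℝ) 1) (WFun.ultraspherical α) ↔ (s : ℝ) - 1 < α := by
  rw [WFun.natCast_le_index_iff]
  constructor
  · intro h
    by_contra! hle
    -- For `s = 1` the assumption `α ≤ s - 1` contradicts `α > 0`; divergence requires at least one
    -- summation.
    have hs2 : 2 ≤ s := by
      by_contra hlt
      have : s = 1 := by omega
      subst this
      norm_num at hle
      linarith
    obtain ⟨c, hc, hlow⟩ := WFun.exists_diffMatrix_lower hα
    exact WFun.not_powerBounded_of_le_abs hc (by linarith)
      (WFun.abs_diffMatrix_ultraspherical_comm hα) hlow hs2 (by linarith) (h s hs le_rfl).2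
  · intro h k _ hks
    obtain ⟨C, hC, hup⟩ := WFun.exists_diffMatrix_upper hα
    have : (k : ℝ) ≤ s := by exact_mod_cast hks
    exact ⟨WFun.entriesFinite_ultraspherical hα,
      WFun.powerBounded_of_abs_le hC.le hup (by linarith)⟩
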